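/- Let $(S,\mathfrak n)$ be a (Noetherian) regular local ring, let $I$ be an ideal of $S$, and put $t=\dim(S)-\dim(S/I)$. Suppose that $I$ is a cohomologically complete intersection ideal on the punctured spectrum of $S$; that is, for every integer $j>t$ the local cohomology module $H^j_I(S)=\varinjlim_k \operatorname{Ext}^j_S(S/I^k,S)$ satisfies $$\operatorname{Supp}_S\big(H^j_I(S)\big)\subseteq\{\mathfrak n\}.$$ Then $S/I$ is equidimensional: $\dim(S/\mathfrak p)=\dim(S/I)$ for every minimal prime $\mathfrak p$ of $I$. (If $I=S$, then the hypothesis and the conclusion are both regarded as vacuously true.) -/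

import Mathlib

universe u

/-- A commutative ring `R` is equidimensional if `dim (R / p) = dim R` for every minimal prime
`p` of `R`. -/
def IsEquidimensionalRing (R : Type u) [CommRing R] : Prop :=
  ∀ p ∈ minimalPrimes R, ringKrullDim (R ⧸ p) = ringKrullDim R

/-- An ideal `I` of a local ring `(S, 𝔫)` is a cohomologically complete intersection ideal on the
punctured spectrum of `S` if, with `t = dim S - dim (S / I)`, one has `Supp H^j_I(S) ⊆ {𝔫}` for all
`j > t`. The condition `j > t` is written without subtraction, as `dim S < dim (S / I) + j`. -/
def IsCCIOnPuncturedSpectrum {S : Type u} [CommRing S] [IsLocalRing S] (I : Ideal S) : Prop :=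
  ∀ j : ℕ, ringKrullDim S < ringKrullDim (S ⧸ I) + (j : WithBot ℕ∞) →
    Module.support S ((localCohomology I j).obj (ModuleCat.of S S)) ⊆ {IsLocalRing.closedPoint S}

/-! ### Regular local rings: domains carrying a regular sequence of length equal to the dimension.
-/

section RegularSequences

open IsLocalRing RingTheory.Sequence

/-! Let `d = dim S`, let `p` be a minimal prime of `I`, put `c = d - dim (S/p)`, and suppose `dim
(S/p) < dim (S/I)`. Then `c > t`. Classically `H^c_I(S)` localizes at `p` to `H^c_{pS_p}(S_p) ≠ 0`,
so the hypothesis forces `p = 𝔫`; as `𝔫` is then minimal over `I`, `dim (S/I) ≤ 0`, a contradiction.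

That `p` lies in the support is shown without localizing (`mem_support_localCohomology`). A nonzero
class in `Ext^c(S/p, S)` is pulled back to `S/I`, and no multiple of it by `r ∉ p` dies in any
`Ext^c(S/I^k, S)`. The input is the vanishing of `Ext^i(N, S)` for `i < d - dim N`
(`subsingleton_ext_of_supportDim_lt`), which rests on `S` having a regular sequence of length `d`.
-/

theorem IsLocalRing.exists_span_insert_eq_maximalIdeal {R : Type*} [CommRing R] [IsLocalRing R]
    {s : Finset R} (hs : Ideal.span (s : Set R) = maximalIdeal R) {x : R}
    (hx : x ∈ maximalIdeal R) (hx2 : x ∉ maximalIdeal R ^ 2) :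
    ∃ t : Finset R, t.card + 1 = s.card ∧
      Ideal.span (insert x (t : Set R)) = maximalIdeal R := by
  classical
  rw [← hs, Ideal.span, Submodule.mem_span_finset] at hx
  obtain ⟨f, -, hf⟩ := hx
  have hsm : ∀ i ∈ s, i ∈ maximalIdeal R := fun i hi ↦ hs ▸ Ideal.subset_span hi
  obtain ⟨i, hi, hfi⟩ : ∃ i ∈ s, IsUnit (f i) := by
    by_contra! h
    refine hx2 (hf ▸ Ideal.sum_mem _ fun i hi ↦ ?_)
    rw [pow_two, smul_eq_mul]
    exact Ideal.mul_mem_mul ((mem_maximalIdeal _).2 (h i hi)) (hsm i hi)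
  refine ⟨s.erase i, Finset.card_erase_add_one hi, le_antisymm ?_ ?_⟩
  · rw [Ideal.span_le]
    rintro y (rfl | hy)
    · exact hf ▸ Ideal.sum_mem _ fun j hj ↦ Ideal.mul_mem_left _ _ (hsm j hj)
    · exact hsm y (Finset.mem_of_mem_erase hy)
  · rw [← hs, Ideal.span_le]
    intro y hy
    by_cases hyi : y = i
    · subst hyi
      have h1 : f y * y ∈ Ideal.span (insert x ((s.erase y : Finset R) : Set R)) := by
        have : f y * y = x - ∑ j ∈ s.erase y, f j • j := by
          rw [← hf, ← Finset.add_sum_erase s _ hi]; simp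
        rw [this]
        exact Ideal.sub_mem _ (Ideal.subset_span (Set.mem_insert _ _)) <|
          Ideal.sum_mem _ fun j hj ↦ Ideal.mul_mem_left _ _ <|
            Ideal.subset_span (Set.mem_insert_of_mem _ hj)
      exact (Ideal.unit_mul_mem_iff_mem _ hfi).1 h1
    · exact Ideal.subset_span (Set.mem_insert_of_mem _ (Finset.mem_erase.2 ⟨hyi, hy⟩))

/-- Killing `x` removes one generator of the maximal ideal by exchange and lowers the dimension by
at most one, so the two numbers still agree. -/
theorem IsLocalRing.quotient_span_singleton_isRegularLocalRing {R : Type*} [CommRing R]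
    [IsRegularLocalRing R] {n : ℕ} (hn : ringKrullDim R = (n + 1 : ℕ)) {x : R}
    (hx : x ∈ maximalIdeal R) (hx2 : x ∉ maximalIdeal R ^ 2) :
    IsRegularLocalRing (R ⧸ Ideal.span {x}) ∧ ringKrullDim (R ⧸ Ideal.span {x}) = n := by
  classical
  have hne : Ideal.span {x} ≠ (⊤ : Ideal R) := fun h ↦ (mem_maximalIdeal x).1 hx
    (Ideal.span_singleton_eq_top.1 h)
  have : Nontrivial (R ⧸ Ideal.span {x}) := Ideal.Quotient.nontrivial_iff.2 hne
  have : IsLocalRing (R ⧸ Ideal.span {x}) :=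
    .of_surjective' (Ideal.Quotient.mk _) Ideal.Quotient.mk_surjective
  have hfg : (maximalIdeal R).FG := IsNoetherian.noetherian _
  have hfin := Submodule.FG.finite_generators hfg
  have hcard : hfin.toFinset.card = n + 1 := by
    rw [← Set.ncard_eq_toFinset_card _ hfin, Submodule.FG.generators_ncard hfg]
    have := IsRegularLocalRing.spanFinrank_maximalIdeal (R := R)
    rw [hn] at this
    exact_mod_cast this
  obtain ⟨t, ht, hspan⟩ := exists_span_insert_eq_maximalIdeal (s := hfin.toFinset)
    (by simpa using (maximalIdeal R).span_generators) hx hx2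
  have hmax : maximalIdeal (R ⧸ Ideal.span {x}) =
      Submodule.span _ ((t.image (Ideal.Quotient.mk (Ideal.span {x})) : Finset _) : Set _) := by
    have h1 : (maximalIdeal R).map (Ideal.Quotient.mk (Ideal.span {x})) =
        maximalIdeal (R ⧸ Ideal.span {x}) := by
      have := Ideal.IsMaximal.map_of_surjective_of_ker_le (m := maximalIdeal R)
        (Ideal.Quotient.mk_surjective (I := Ideal.span {x}))
        (by rwa [Ideal.mk_ker, Ideal.span_singleton_le_iff_mem])
      exact eq_maximalIdeal this
    rw [← h1, ← hspan, Ideal.map_span, Set.image_insert_eq, Ideal.span_insert]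
    have : (Ideal.Quotient.mk (Ideal.span {x})) x = 0 :=
      Ideal.Quotient.eq_zero_iff_mem.2 (Ideal.mem_span_singleton_self x)
    rw [this]
    simp [Ideal.span]
  have hle : (maximalIdeal (R ⧸ Ideal.span {x})).spanFinrank ≤ n := by
    rw [hmax]
    refine (Submodule.spanFinrank_span_le_ncard_of_finite (Finset.finite_toSet _)).trans ?_
    rw [Set.ncard_coe_finset]
    exact Finset.card_image_le.trans (by omega)
  have hdim : (n : WithBot ℕ∞) ≤ ringKrullDim (R ⧸ Ideal.span {x}) := by
    have h := ringKrullDim_le_ringKrullDim_quotient_add_card ({x} : Finset R)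
      (by simpa [ringJacobson_eq_maximalIdeal] using hx)
    rw [hn, Finset.coe_singleton, Finset.card_singleton, Nat.cast_add, Nat.cast_one] at h
    exact ENat.WithBot.add_le_add_natCast_right_iff.mp h
  have hreg : IsRegularLocalRing (R ⧸ Ideal.span {x}) :=
    .of_spanFinrank_maximalIdeal_le _ (le_trans (by exact_mod_cast hle) hdim)
  refine ⟨hreg, le_antisymm ?_ hdim⟩
  rw [← hreg.spanFinrank_maximalIdeal]
  exact_mod_cast hle

/-- A minimal prime `P` inside `(x)` satisfies `P = xP` since `x ∉ P`, so `P = 0` by Nakayama. -/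
theorem IsLocalRing.isDomain_of_isPrime_span_singleton {R : Type*} [CommRing R] [IsLocalRing R]
    [IsNoetherianRing R] {x : R} (hx : x ∈ maximalIdeal R) (hmin : ∀ P ∈ minimalPrimes R, x ∉ P)
    [hp : (Ideal.span {x}).IsPrime] : IsDomain R := by
  obtain ⟨P, hP, hPx⟩ := Ideal.exists_minimalPrimes_le (bot_le : ⊥ ≤ Ideal.span {x})
  have hPp : P.IsPrime := hP.1.1
  have hle : P ≤ maximalIdeal R • P := by
    intro y hy
    obtain ⟨z, rfl⟩ := Ideal.mem_span_singleton'.1 (hPx hy)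
    have hz : z ∈ P := (hPp.mem_or_mem hy).resolve_right (hmin P hP)
    rw [mul_comm]
    exact Ideal.mul_mem_mul hx hz
  have hbot : P = ⊥ := Submodule.eq_bot_of_le_smul_of_le_jacobson_bot _ P
    (IsNoetherian.noetherian P) hle (maximalIdeal_le_jacobson _)
  rw [hbot] at hPp
  exact (IsDomain.of_bot_isPrime R)

/-- Both claims share one induction: being a domain is what makes the next `x` a nonzerodivisor. -/
theorem IsRegularLocalRing.isDomain_and_exists_isWeaklyRegular (n : ℕ) :
    ∀ (R : Type*) [CommRing R] [IsRegularLocalRing R], ringKrullDim R = n →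
      IsDomain R ∧ ∃ rs : List R, rs.length = n ∧ (∀ r ∈ rs, r ∈ maximalIdeal R) ∧
        IsWeaklyRegular R rs := by
  induction n with
  | zero =>
    intro R _ _ h
    refine ⟨?_, [], by simp⟩
    have h0 : (maximalIdeal R).spanFinrank = 0 := by
      have := IsRegularLocalRing.spanFinrank_maximalIdeal (R := R)
      rw [h] at this
      exact_mod_cast this
    rw [Submodule.spanFinrank_eq_zero_iff_eq_bot (IsNoetherian.noetherian _)] at h0
    have := (isField_iff_maximalIdeal_eq (R := R)).2 h0
    exact this.isDomain
  | succ n ih =>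
    intro R _ _ h
    obtain ⟨x, hx, hx2, hmin⟩ : ∃ x ∈ maximalIdeal R, x ∉ maximalIdeal R ^ 2 ∧
        ∀ P ∈ minimalPrimes R, x ∉ P := by
      by_contra! hcon
      have hfin := minimalPrimes.finite_of_isNoetherianRing R
      -- Prime avoidance tolerates two ideals that need not be prime; the square of the maximal
      -- ideal fills both slots.
      have hsub := (Ideal.subset_union_prime' (s := hfin.toFinset) (f := id)
        (a := maximalIdeal R ^ 2) (b := maximalIdeal R ^ 2) (I := maximalIdeal R)
        (fun i hi ↦ ((hfin.mem_toFinset).1 hi).1.1)).1 (by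
          intro x hx
          by_cases hx2 : x ∈ maximalIdeal R ^ 2
          · exact Or.inl (Or.inl hx2)
          · obtain ⟨P, hP, hxP⟩ := hcon x hx hx2
            exact Or.inr (Set.mem_biUnion ((hfin.mem_toFinset).2 hP) hxP))
      have hsq : ¬ maximalIdeal R ≤ maximalIdeal R ^ 2 := by
        intro hle
        rw [pow_two] at hle
        have := Submodule.eq_bot_of_le_smul_of_le_jacobson_bot _ (maximalIdeal R)
          (IsNoetherian.noetherian _) hle (maximalIdeal_le_jacobson _)
        have hF := (isField_iff_maximalIdeal_eq (R := R)).2 this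
        rw [ringKrullDim_eq_zero_of_isField hF] at h
        norm_cast at h
      rcases hsub with hsub | hsub | ⟨P, hP, hsub⟩
      · exact hsq hsub
      · exact hsq hsub
      · have hP' := (hfin.mem_toFinset).1 hP
        have hPp : P.IsPrime := hP'.1.1
        have hPm : P = maximalIdeal R := le_antisymm (le_maximalIdeal hPp.ne_top) hsub
        have h0 : (maximalIdeal R).height = 0 := by
          rw [Ideal.height_eq_zero_iff, ← hPm]
          exact hP'
        have h2 := maximalIdeal_height_eq_ringKrullDim (R := R)
        rw [h0, h] at h2
        norm_cast at h2
    obtain ⟨hreg, hdim⟩ := quotient_span_singleton_isRegularLocalRing h hx hx2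
    obtain ⟨hdom, rs, hlen, hmem, hrs⟩ := ih (R ⧸ Ideal.span {x}) hdim
    have hprime : (Ideal.span {x}).IsPrime := (Ideal.Quotient.isDomain_iff_prime _).1 hdom
    have hR : IsDomain R := isDomain_of_isPrime_span_singleton hx hmin
    have hx0 : x ≠ 0 := by rintro rfl; exact hx2 (Ideal.zero_mem _)
    obtain ⟨rs, rfl⟩ := List.map_surjective_iff.2
      (Ideal.Quotient.mk_surjective (I := Ideal.span {x})) rs
    refine ⟨hR, x :: rs, by simpa using hlen, ?_, ?_⟩
    · rintro r (_ | ⟨_, hr⟩)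
      · exact hx
      · have := hmem _ (List.mem_map_of_mem hr)
        rw [mem_maximalIdeal, mem_nonunits_iff] at this ⊢
        exact fun hu ↦ this (hu.map _)
    · rw [isWeaklyRegular_cons_iff]
      refine ⟨(IsSMulRegular.of_ne_zero hx0), ?_⟩
      have h3 := (isWeaklyRegular_map_algebraMap_iff (R ⧸ Ideal.span {x})
        (R ⧸ Ideal.span {x}) rs).1 hrs
      refine (LinearEquiv.isWeaklyRegular_congr (Submodule.quotEquivOfEq _ _ ?_) rs).1 h3
      simp [← Submodule.ideal_span_singleton_smul]

theorem IsRegularLocalRing.exists_isRegular_length_eq_ringKrullDim (R : Type*) [CommRing R]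
    [IsRegularLocalRing R] {n : ℕ} (hn : ringKrullDim R = n) :
    ∃ rs : List R, rs.length = n ∧ (∀ r ∈ rs, r ∈ maximalIdeal R) ∧ IsRegular R rs := by
  obtain ⟨-, rs, hlen, hmem, hrs⟩ := isDomain_and_exists_isWeaklyRegular n R hn
  exact ⟨rs, hlen, hmem, (isRegular_iff_isWeaklyRegular_of_subset_maximalIdeal hmem).2 hrs⟩

end RegularSequences

/-! ### Vanishing, nonvanishing and torsion-freeness of Ext into a regular local ring. -/

section Grade

open IsLocalRing RingTheory.Sequence CategoryTheory Abelian Module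

variable {S : Type u} [CommRing S]

theorem IsLocalRing.subsingleton_ext_of_smul_surjective [IsLocalRing S] [IsNoetherianRing S]
    {N M : ModuleCat.{u} S} [Module.Finite S N] [Module.Finite S M] {r : S}
    (hr : r ∈ maximalIdeal S) (i : ℕ) (h : ∀ x : Ext N M i, ∃ y : Ext N M i, r • y = x) :
    Subsingleton (Ext N M i) := by
  have hle : (⊤ : Submodule S (Ext N M i)) ≤ maximalIdeal S • ⊤ := by
    intro x _
    obtain ⟨y, rfl⟩ := h x
    exact Submodule.smul_mem_smul hr trivial
  have := Submodule.eq_bot_of_le_smul_of_le_jacobson_bot _ _ Module.Finite.fg_top hle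
    (maximalIdeal_le_jacobson _)
  exact (Submodule.subsingleton_iff S).1 (subsingleton_of_bot_eq_top this.symm)

theorem CategoryTheory.Abelian.Ext.mk₀_smul_id_comp {N M : ModuleCat.{u} S} (r : S) {i : ℕ}
    (x : Ext N M i) : (Ext.mk₀ (r • 𝟙 N)).comp x (zero_add i) = r • x := by
  simp [Ext.mk₀_smul]

theorem CategoryTheory.Abelian.Ext.exists_smul_eq_of_subsingleton {N : ModuleCat.{u} S} {r : S}
    (hr : IsSMulRegular N r) (M : ModuleCat.{u} S) (i : ℕ)
    [Subsingleton (Ext (ModuleCat.of S (QuotSMulTop r N)) M (i + 1))] (x : Ext N M i) :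
    ∃ y : Ext N M i, r • y = x := by
  obtain ⟨y, hy⟩ := Ext.contravariant_sequence_exact₁ hr.smulShortComplex_shortExact M x
    (add_comm 1 i) (Subsingleton.elim (α := Ext (ModuleCat.of S (QuotSMulTop r N)) M (i + 1)) _ _)
  exact ⟨y, (Ext.mk₀_smul_id_comp r _).symm.trans hy⟩

theorem CategoryTheory.Abelian.Ext.eq_zero_of_smul_eq_zero {N : ModuleCat.{u} S} {r : S}
    (hr : IsSMulRegular N r) (M : ModuleCat.{u} S) (i : ℕ)
    [Subsingleton (Ext (ModuleCat.of S (QuotSMulTop r N)) M i)] {x : Ext N M i}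
    (hx : r • x = 0) : x = 0 := by
  obtain ⟨y, hy⟩ := Ext.contravariant_sequence_exact₂ hr.smulShortComplex_shortExact M x
    ((Ext.mk₀_smul_id_comp r x).trans hx)
  have hy0 : y = 0 :=
    Subsingleton.elim (α := Ext (ModuleCat.of S (QuotSMulTop r N)) M i) _ _
  subst hy0
  exact hy.symm.trans (Ext.comp_zero _ _ _ _ _)

theorem CategoryTheory.Abelian.Ext.subsingleton_of_iso {N N' M : ModuleCat.{u} S} (e : N ≅ N')
    (i : ℕ) [Subsingleton (Ext N' M i)] : Subsingleton (Ext N M i) := by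
  refine subsingleton_of_forall_eq 0 fun x ↦ ?_
  rw [← Ext.mk₀_id_comp x, ← e.hom_inv_id, ← Ext.mk₀_comp_mk₀_assoc,
    Subsingleton.elim ((Ext.mk₀ e.inv).comp x (zero_add i)) 0, Ext.comp_zero]

theorem isSMulRegular_quotient_of_notMem {p : Ideal S} [p.IsPrime] {r : S} (hr : r ∉ p) :
    IsSMulRegular (S ⧸ p) r := by
  rw [isSMulRegular_iff_right_eq_zero_of_smul]
  intro x hx
  rw [Algebra.smul_def] at hx
  exact (mul_eq_zero.1 hx).resolve_left fun h ↦ hr (Ideal.Quotient.eq_zero_iff_mem.1 h)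

theorem Module.supportDim_quotSMulTop_lt [IsLocalRing S] [IsNoetherianRing S] {N : Type*}
    [AddCommGroup N] [Module S N] [Module.Finite S N] {r : S} (hr : IsSMulRegular N r)
    (hm : r ∈ maximalIdeal S) {m : ℕ} (h : supportDim S N < (m + 1 : ℕ)) :
    supportDim S (QuotSMulTop r N) < m := by
  rw [← supportDim_quotSMulTop_succ_eq_supportDim hr hm, Nat.cast_add, Nat.cast_one] at h
  exact lt_of_add_lt_add_right h

variable [IsRegularLocalRing S] {d : ℕ}

theorem IsRegularLocalRing.subsingleton_ext_residueField (hd : ringKrullDim S = d) {i : ℕ}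
    (hi : i < d) :
    Subsingleton (Ext (ModuleCat.of S (S ⧸ maximalIdeal S)) (ModuleCat.of S S) i) := by
  obtain ⟨rs, hlen, hmem, hrs⟩ := exists_isRegular_length_eq_ringKrullDim S hd
  refine ModuleCat.subsingleton_ext_of_exists_isRegular (maximalIdeal S) _ ?_ _ ?_ rs hmem hrs i
    (hlen ▸ hi)
  · rw [Module.support_eq_zeroLocus, Ideal.annihilator_quotient]
  · simpa using Ideal.IsPrime.ne_top'.lt_top

/-- Induction on the dimension bound, with dévissage to `N = S/q`. For `q` not maximal, some nonunit
`r ∉ q` is regular on `S/q`; vanishing of `Ext^(i+1)` on the smaller quotient makes `r` surjective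
on `Ext^i`, and Nakayama concludes. -/
theorem IsRegularLocalRing.subsingleton_ext_of_supportDim_lt (hd : ringKrullDim S = d) (m : ℕ) :
    ∀ (N : Type u) [AddCommGroup N] [Module S N] [Module.Finite S N], supportDim S N < m →
      ∀ i, i + m ≤ d → Subsingleton (Ext (ModuleCat.of S N) (ModuleCat.of S S) i) := by
  induction m with
  | zero =>
    intro N _ _ _ h i _
    have : Subsingleton N := by
      by_contra hN
      rw [not_subsingleton_iff_nontrivial] at hN
      rw [supportDim_eq_ringKrullDim_quotient_annihilator] at h
      have : Nontrivial (S ⧸ annihilator S N) :=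
        Ideal.Quotient.nontrivial_iff.2 fun h ↦ not_subsingleton N (annihilator_eq_top_iff.1 h)
      exact absurd h (not_lt.2 ringKrullDim_nonneg_of_nontrivial)
    refine subsingleton_of_forall_eq 0 fun x ↦ ?_
    rw [← Ext.mk₀_id_comp x, (ModuleCat.isZero_of_subsingleton (ModuleCat.of S N)).eq_of_src
      (𝟙 (ModuleCat.of S N)) 0, Ext.mk₀_zero, Ext.zero_comp]
  | succ m ih =>
    intro N _ _ _
    refine IsNoetherianRing.induction_on_isQuotientEquivQuotientPrime S (M := N) inferInstance
      (motive := fun N _ _ _ ↦ supportDim S N < (m + 1 : ℕ) → ∀ i, i + (m + 1) ≤ d →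
        Subsingleton (Ext (ModuleCat.of S N) (ModuleCat.of S S) i)) ?_ ?_ ?_
    · intro N _ _ _ _ _ i hi
      have hN : supportDim S N < m := by
        rw [supportDim_eq_bot_of_subsingleton]
        exact WithBot.bot_lt_coe _
      exact ih N hN i (by omega)
    · intro N _ _ _ q e h i hi
      suffices Subsingleton (Ext (ModuleCat.of S (S ⧸ q.asIdeal)) (ModuleCat.of S S) i) from
        Ext.subsingleton_of_iso e.toModuleIso i
      rw [supportDim_eq_of_equiv e] at h
      by_cases hq : q.asIdeal = maximalIdeal S
      · rw [hq]
        exact subsingleton_ext_residueField hd (by omega)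
      · obtain ⟨r, hrm, hrq⟩ := SetLike.exists_of_lt
          ((le_maximalIdeal q.isPrime.ne_top).lt_of_ne hq)
        have hreg := isSMulRegular_quotient_of_notMem hrq
        have := ih _ (supportDim_quotSMulTop_lt hreg hrm h) (i + 1) (by omega)
        exact subsingleton_ext_of_smul_surjective (N := ModuleCat.of S (S ⧸ q.asIdeal))
          (M := ModuleCat.of S S) hrm i
          (Ext.exists_smul_eq_of_subsingleton (N := ModuleCat.of S (S ⧸ q.asIdeal)) hreg _ i)
    · intro N₁ _ _ _ N₂ _ _ _ N₃ _ _ _ f g hf hg hfg h₁ h₃ h i hi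
      have s₁ := h₁ ((supportDim_le_of_injective f hf).trans_lt h) i hi
      have s₃ := h₃ ((supportDim_le_of_surjective g hg).trans_lt h) i hi
      have hS : (ModuleCat.shortComplexOfCompEqZero f g hfg.linearMap_comp_eq_zero).ShortExact :=
        { exact := ModuleCat.shortComplex_exact _ hfg
          mono_f := (ModuleCat.mono_iff_injective _).2 hf
          epi_g := (ModuleCat.epi_iff_surjective _).2 hg }
      refine subsingleton_of_forall_eq 0 fun x ↦ ?_
      obtain ⟨y, hy⟩ := Ext.contravariant_sequence_exact₂ hS (ModuleCat.of S S) x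
        (Subsingleton.elim (α := Ext (ModuleCat.of S N₁) (ModuleCat.of S S) i) _ _)
      have hy0 : y = 0 := Subsingleton.elim (α := Ext (ModuleCat.of S N₃) (ModuleCat.of S S) i) _ _
      subst hy0
      exact hy.symm.trans (Ext.comp_zero _ _ _ _ _)

variable {p : Ideal S} {m j : ℕ}

/-- Otherwise Ext vanishes in all degrees up to `j`, so `p` contains a regular sequence of length `j
+ 1`, too long for `dim S = j + dim (S/p)`. -/
theorem IsRegularLocalRing.nontrivial_ext_quotient [p.IsPrime] (hd : ringKrullDim S = d)
    (hm : ringKrullDim (S ⧸ p) = m) (hj : j + m = d) :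
    Nontrivial (Ext (ModuleCat.of S (S ⧸ p)) (ModuleCat.of S S) j) := by
  by_contra hcon
  rw [not_nontrivial_iff_subsingleton] at hcon
  obtain ⟨rs, hlen, hmem, hrs⟩ := ModuleCat.exists_isRegular_of_exists_subsingleton_ext p (j + 1)
    (ModuleCat.of S S) (by simpa using (Ideal.IsPrime.ne_top' (I := p)).lt_top)
    (ModuleCat.of S (S ⧸ p)) (by rw [Module.support_eq_zeroLocus, Ideal.annihilator_quotient])
    (fun i hi ↦ by
      rcases (Nat.lt_succ_iff.1 hi).lt_or_eq with hi | rfl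
      · refine subsingleton_ext_of_supportDim_lt hd (m + 1) _ ?_ i (by omega)
        rw [supportDim_quotient_eq_ringKrullDim, hm]
        exact_mod_cast Nat.lt_succ_self m
      · exact hcon)
  have h1 := ringKrullDim_add_length_eq_ringKrullDim_of_isRegular rs hrs
  have h2 : ringKrullDim (S ⧸ p) ≤ ringKrullDim (S ⧸ Ideal.ofList rs) :=
    ringKrullDim_le_of_surjective (Ideal.Quotient.factor (Ideal.span_le.2 hmem))
      (Ideal.Quotient.factor_surjective _)
  have h3 : ((m + (j + 1) : ℕ) : WithBot ℕ∞) ≤ (d : ℕ) := by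
    rw [← hd, ← h1, hlen, Nat.cast_add, ← hm]
    gcongr
  have : m + (j + 1) ≤ d := by exact_mod_cast h3
  omega

/-- For a nonunit `r`, the kernel of `r` is the image of `Ext^j` of a quotient of dimension below
`m`, which vanishes. -/
theorem IsRegularLocalRing.eq_zero_of_smul_ext_quotient_eq_zero [p.IsPrime]
    (hd : ringKrullDim S = d)
    (hm : ringKrullDim (S ⧸ p) = m) (hj : j + m = d) {r : S} (hr : r ∉ p)
    {x : Ext (ModuleCat.of S (S ⧸ p)) (ModuleCat.of S S) j} (hx : r • x = 0) : x = 0 := by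
  by_cases hu : IsUnit r
  · exact hu.smul_eq_zero.1 hx
  · have hreg := isSMulRegular_quotient_of_notMem hr
    have := subsingleton_ext_of_supportDim_lt hd m _ (supportDim_quotSMulTop_lt hreg hu (by
      rw [supportDim_quotient_eq_ringKrullDim, hm]
      exact_mod_cast Nat.lt_succ_self m)) j (by omega)
    exact Ext.eq_zero_of_smul_eq_zero (N := ModuleCat.of S (S ⧸ p)) hreg _ j hx

/-- The obstruction is `Ext^j(ker f, S)`, which vanishes because `ker f` has dimension at most `m`.
-/
theorem IsRegularLocalRing.precomp_ext_quotient_pow_injective (hd : ringKrullDim S = d)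
    (hm : ringKrullDim (S ⧸ p) = m) (hj : j + 1 + m = d) {n : ℕ} (hn : n ≠ 0)
    (f : S ⧸ p ^ n →ₗ[S] S ⧸ p) (hf : Function.Surjective f)
    {x : Ext (ModuleCat.of S (S ⧸ p)) (ModuleCat.of S S) (j + 1)}
    (hx : (Ext.mk₀ (ModuleCat.ofHom f)).comp x (zero_add _) = 0) : x = 0 := by
  have hker : Subsingleton (Ext (ModuleCat.of S (LinearMap.ker f)) (ModuleCat.of S S) j) := by
    refine subsingleton_ext_of_supportDim_lt hd (m + 1) _ ?_ j (by omega)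
    refine (supportDim_le_of_injective (LinearMap.ker f).subtype
      (Submodule.subtype_injective _)).trans_lt ?_
    have : Module.support S (S ⧸ p ^ n) = Module.support S (S ⧸ p) := by
      rw [Module.support_eq_zeroLocus, Module.support_eq_zeroLocus, Ideal.annihilator_quotient,
        Ideal.annihilator_quotient, PrimeSpectrum.zeroLocus_pow p hn]
    rw [supportDim, this, ← supportDim, supportDim_quotient_eq_ringKrullDim, hm]
    exact_mod_cast Nat.lt_succ_self m
  obtain ⟨y, hy⟩ := Ext.contravariant_sequence_exact₃ (LinearMap.shortExact_shortComplexKer hf)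
    (ModuleCat.of S S) x hx (add_comm 1 j)
  have hy0 : y = 0 := Subsingleton.elim
    (α := Ext (ModuleCat.of S (LinearMap.ker f)) (ModuleCat.of S S) j) _ _
  subst hy0
  exact hy.symm.trans (Ext.comp_zero _ _ _ _ _)

end Grade

/-! ### Cocycle description of the derived-functor `Ext`, the one used to define local cohomology.
-/

section DerivedExt

open CategoryTheory Limits Opposite

theorem HomologicalComplex.homologyUnop_inv_naturality {V : Type*} [Category* V]
    [HasZeroMorphisms V] {ι : Type*} {c : ComplexShape ι} {K L : HomologicalComplex Vᵒᵖ c}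
    (φ : K ⟶ L) (i : ι) [K.HasHomology i] [L.HasHomology i] :
    (HomologicalComplex.homologyMap φ i).unop ≫ (K.homologyUnop i).inv =
      (L.homologyUnop i).inv ≫
        HomologicalComplex.homologyMap ((HomologicalComplex.unopFunctor _ _).map φ.op) i := by
  let ψ : L.unop ⟶ K.unop := (HomologicalComplex.unopFunctor _ _).map φ.op
  have h : HomologicalComplex.homologyMap (K := K.unop.op) (L := L.unop.op) φ i ≫
      (L.unop.homologyOp i).hom =
        (K.unop.homologyOp i).hom ≫ (HomologicalComplex.homologyMap ψ i).op :=
    HomologicalComplex.homologyOp_hom_naturality ψ i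
  exact congrArg Quiver.Hom.unop
    (((K.unop.homologyOp i).inv_comp_eq.2 ((Iso.eq_comp_inv _).2 h |>.trans (Category.assoc _ _ _))))

theorem HomologicalComplex.homologyπ_eq_zero_iff {R : Type*} [Ring R] {ι : Type*}
    {c : ComplexShape ι} (K : HomologicalComplex (ModuleCat R) c) {i k : ι} (hk : c.prev i = k)
    (z : K.cycles i) : K.homologyπ i z = 0 ↔ ∃ y, K.d k i y = K.iCycles i z := by
  subst hk
  refine Iff.trans ?_ ((K.sc i).moduleCat_pOpcycles_eq_zero_iff (K.iCycles i z))
  rw [← map_eq_zero_iff _ ((ModuleCat.mono_iff_injective (K.homologyι i)).1 inferInstance),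
    ← ConcreteCategory.comp_apply, K.homology_π_ι]
  rfl

namespace CategoryTheory.ProjectiveResolution

variable {R : Type*} [Ring R] {C : Type*} [Category* C] [Abelian C] [Linear R C]
  [EnoughProjectives C]

/-- The map on `Hom`-complexes induced by a chain map. -/
noncomputable abbrev linearYonedaMap (R : Type*) [Ring R] [Linear R C]
   {K L : ChainComplex C ℕ} (φ : K ⟶ L) (Y : C) :
    L.linearYonedaObj R Y ⟶ K.linearYonedaObj R Y :=
  (HomologicalComplex.unopFunctor _ _).map
    ((((linearYoneda R C).obj Y).rightOp.mapHomologicalComplex _).map φ).op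

theorem isoExt_hom_naturality {X X' : C} {P : ProjectiveResolution X} {P' : ProjectiveResolution X'}
    {g : X ⟶ X'} (φ : Hom P P' g) (n : ℕ) (Y : C) :
    ((Ext R C n).map g.op).app Y ≫ (P.isoExt n Y).hom =
      (P'.isoExt n Y).hom ≫ HomologicalComplex.homologyMap (linearYonedaMap R φ.hom Y) n := by
  have h := congrArg Quiver.Hom.unop (isoLeftDerivedObj_inv_naturality g P P' φ.hom
      (by simpa using φ.hom_f_zero_comp_π_f_zero)
    ((linearYoneda R C).obj Y).rightOp n)
  have h2 := HomologicalComplex.homologyUnop_inv_naturality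
    ((((linearYoneda R C).obj Y).rightOp.mapHomologicalComplex _).map φ.hom) n
  simp only [unop_comp] at h
  change _ ≫ (P.isoLeftDerivedObj ((linearYoneda R C).obj Y).rightOp n).inv.unop ≫ _ =
    ((P'.isoLeftDerivedObj ((linearYoneda R C).obj Y).rightOp n).inv.unop ≫ _) ≫ _
  refine (Category.assoc _ _ _).symm.trans ?_
  refine (congrArg (· ≫ _) h).trans ?_
  refine (Category.assoc _ _ _).trans ?_
  refine Eq.trans ?_ (Category.assoc _ _ _).symm
  exact congrArg (_ ≫ ·) h2

variable {X : C} (P : ProjectiveResolution X) {Y : C} {n : ℕ}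

omit [EnoughProjectives C] in
theorem iCycles_cyclesMk_linearYonedaObj (f : P.complex.X n ⟶ Y)
    (hf : P.complex.d (n + 1) n ≫ f = 0) :
    (P.complex.linearYonedaObj R Y).iCycles n
      ((P.complex.linearYonedaObj R Y).cyclesMk f (n + 1) (by simp) hf) = f :=
  (P.complex.linearYonedaObj R Y).i_cyclesMk f (n + 1) (by simp) hf

/-- The class of a cocycle in `Ext`, computed by a projective resolution. -/
noncomputable def derivedExtMk (f : P.complex.X n ⟶ Y) (hf : P.complex.d (n + 1) n ≫ f = 0) :
    ((Ext R C n).obj (op X)).obj Y :=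
  (P.isoExt n Y).inv ((P.complex.linearYonedaObj R Y).homologyπ n
    ((P.complex.linearYonedaObj R Y).cyclesMk f (n + 1) (by simp) hf))

theorem derivedExtMk_eq_zero {m : ℕ} {f : P.complex.X (m + 1) ⟶ Y}
    {hf : P.complex.d (m + 1 + 1) (m + 1) ≫ f = 0}
    (h : P.derivedExtMk (R := R) f hf = 0) : ∃ g : P.complex.X m ⟶ Y,
      P.complex.d (m + 1) m ≫ g = f := by
  rw [derivedExtMk, map_eq_zero_iff _ ((ModuleCat.mono_iff_injective _).1 inferInstance),
    HomologicalComplex.homologyπ_eq_zero_iff _ (k := m) (by simp)] at h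
  obtain ⟨g, hg⟩ := h
  exact ⟨g, hg.trans (P.iCycles_cyclesMk_linearYonedaObj f hf)⟩

theorem smul_derivedExtMk (r : R) (f : P.complex.X n ⟶ Y) (hf : P.complex.d (n + 1) n ≫ f = 0) :
    r • P.derivedExtMk (R := R) f hf = P.derivedExtMk (r • f) (by simp [hf]) := by
  unfold derivedExtMk
  rw [← map_smul, ← map_smul]
  congr 2
  apply (ModuleCat.mono_iff_injective
    ((P.complex.linearYonedaObj R Y).iCycles n)).1 inferInstance
  rw [map_smul, iCycles_cyclesMk_linearYonedaObj, iCycles_cyclesMk_linearYonedaObj]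
  rfl

theorem map_derivedExtMk {X' : C} {P' : ProjectiveResolution X'} {g : X' ⟶ X} (φ : Hom P' P g)
    (f : P.complex.X n ⟶ Y) (hf : P.complex.d (n + 1) n ≫ f = 0) :
    ((Ext R C n).map g.op).app Y (P.derivedExtMk (R := R) f hf) =
      P'.derivedExtMk (φ.hom.f n ≫ f) (by simp [← φ.hom.comm_assoc, hf]) := by
  have h := isoExt_hom_naturality (R := R) φ n Y
  rw [← Iso.eq_comp_inv] at h
  rw [h, derivedExtMk, derivedExtMk]
  simp only [Category.assoc, ConcreteCategory.comp_apply]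
  congr 1
  rw [← ConcreteCategory.comp_apply (P.isoExt n Y).inv, Iso.inv_hom_id, ConcreteCategory.id_apply,
    ← ConcreteCategory.comp_apply, HomologicalComplex.homologyπ_naturality,
    ConcreteCategory.comp_apply]
  congr 1
  apply (ModuleCat.mono_iff_injective
    ((P'.complex.linearYonedaObj R Y).iCycles n)).1 inferInstance
  rw [← ConcreteCategory.comp_apply, HomologicalComplex.cyclesMap_i, ConcreteCategory.comp_apply,
    iCycles_cyclesMk_linearYonedaObj, iCycles_cyclesMk_linearYonedaObj]
  rfl

end CategoryTheory.ProjectiveResolution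

end DerivedExt

/-! ### Support of local cohomology at minimal primes. -/

section LocalCohomology

open CategoryTheory Limits Opposite

theorem CategoryTheory.ProjectiveResolution.smul_extMk {R : Type*} [Ring R] {C : Type*}
    [Category* C] [Abelian C] [HasExt C] [Linear R C] {X Y : C} (P : ProjectiveResolution X) {n : ℕ}
    (r : R) (f : P.complex.X n ⟶ Y) (m : ℕ) (hm : n + 1 = m) (hf : P.complex.d m n ≫ f = 0) :
    r • P.extMk f m hm hf = P.extMk (r • f) m hm (by simp [hf]) := by
  rw [Abelian.Ext.smul_eq_comp_mk₀, extMk_comp_mk₀]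
  simp

namespace localCohomology

variable {S : Type u} [CommRing S]

/-- The canonical projection `S ⧸ I ^ k ⟶ S ⧸ I ^ l` for `l ≤ k`. -/
noncomputable abbrev quotientPowMap (I : Ideal S) {l k : ℕ} (h : l ≤ k) :
    ModuleCat.of S (S ⧸ I ^ k) ⟶ ModuleCat.of S (S ⧸ I ^ l) :=
  ModuleCat.ofHom (Submodule.mapQ _ _ LinearMap.id (Ideal.pow_le_pow_right h))

/-- The canonical map `Ext^j(S ⧸ I ^ k, M) ⟶ H^j_I(M)`. -/
noncomputable def ι (I : Ideal S) (j k : ℕ) (M : ModuleCat.{u} S) :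
    ((Ext S (ModuleCat.{u} S) j).obj (op (ModuleCat.of S (S ⧸ I ^ k)))).obj M ⟶
      (localCohomology I j).obj M :=
  (colimit.ι (diagram (idealPowersDiagram I) j) (op (op k))).app M

theorem exists_map_eq_zero_of_ι_eq_zero (I : Ideal S) (j l : ℕ) (M : ModuleCat.{u} S)
    (x : ((Ext S (ModuleCat.{u} S) j).obj (op (ModuleCat.of S (S ⧸ I ^ l)))).obj M)
    (hx : ι I j l M x = 0) :
    ∃ (k : ℕ) (h : l ≤ k),
      ((Ext S (ModuleCat.{u} S) j).map (quotientPowMap I h).op).app M x = 0 := by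
  let F := diagram (idealPowersDiagram I) j
  have hc := isColimitOfPreserves ((evaluation (ModuleCat.{u} S) (ModuleCat.{u} S)).obj M)
    (colimit.isColimit F)
  have : PreservesFilteredColimitsOfSize.{0, 0} (forget (ModuleCat.{u} S)) :=
    preservesFilteredColimitsOfSize_shrink.{0, u, 0, u} _
  obtain ⟨k, f, g, hfg⟩ := Concrete.isColimit_exists_of_rep_eq _ (i := op (op l))
    (j := op (op l)) hc x 0 (hx.trans (map_zero _).symm)
  refine ⟨k.unop.unop, f.unop.unop.down.down, ?_⟩
  exact hfg.trans (map_zero _)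

/-- Bridge between the two Ext theories: on projective resolutions, a class vanishes in either one
exactly when its cocycle is a coboundary. -/
theorem mem_support_of_ext (I : Ideal S) (j l : ℕ) (M : ModuleCat.{u} S) (p : PrimeSpectrum S)
    (e : Abelian.Ext (ModuleCat.of S (S ⧸ I ^ l)) M (j + 1))
    (he : ∀ (k : ℕ) (h : l ≤ k), ∀ r ∉ p.asIdeal,
      r • (Abelian.Ext.mk₀ (quotientPowMap I h)).comp e (zero_add _) ≠ 0) :
    p ∈ Module.support S ((localCohomology I (j + 1)).obj M) := by
  rw [Module.mem_support_iff']
  let P := projectiveResolution (ModuleCat.of S (S ⧸ I ^ l))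
  obtain ⟨f, hf, rfl⟩ := P.extMk_surjective e (j + 1 + 1) rfl
  refine ⟨ι I (j + 1) l M (P.derivedExtMk f hf), fun r hr h0 ↦ ?_⟩
  rw [← map_smul, ProjectiveResolution.smul_derivedExtMk] at h0
  obtain ⟨k, hk, h0⟩ := exists_map_eq_zero_of_ι_eq_zero I (j + 1) l M _ h0
  let P' := projectiveResolution (ModuleCat.of S (S ⧸ I ^ k))
  let φ : ProjectiveResolution.Hom P' P (quotientPowMap I hk) :=
    { hom := ProjectiveResolution.lift (quotientPowMap I hk) P' P
      hom_f_zero_comp_π_f_zero :=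
        (ProjectiveResolution.lift_commutes_zero _ _ _).trans (by simp) }
  rw [ProjectiveResolution.map_derivedExtMk P φ] at h0
  obtain ⟨g, hg⟩ := P'.derivedExtMk_eq_zero h0
  refine he k hk r hr ?_
  rw [← Abelian.Ext.comp_smul, ProjectiveResolution.smul_extMk,
    ProjectiveResolution.mk₀_comp_extMk _ _ _ _ φ, P'.extMk_eq_zero_iff _ _ _ _ j rfl]
  exact ⟨g, hg⟩

end localCohomology

/-- Denominator-free form of `p^n S_p ⊆ J S_p`: take `s` in every other minimal prime but not in
`p`, so that `sp` lies in the radical of `J`. -/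
theorem Ideal.exists_mul_pow_le_of_mem_minimalPrimes {S : Type*} [CommRing S] [IsNoetherianRing S]
    {J p : Ideal S} (hp : p ∈ J.minimalPrimes) :
    ∃ s ∉ p, ∃ n ≠ 0, Ideal.span {s} * p ^ n ≤ J := by
  have hpp : p.IsPrime := hp.1.1
  have hfin := J.finite_minimalPrimes_of_isNoetherianRing S
  obtain ⟨s, hs, hsp⟩ : ∃ s ∈ (hfin.toFinset.erase p).inf id, s ∉ p := by
    by_contra! h
    obtain ⟨q, hq, hqp⟩ := (hpp.inf_le' (s := hfin.toFinset.erase p) (f := id)).1 h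
    rw [Finset.mem_erase, hfin.mem_toFinset] at hq
    exact hq.1 (le_antisymm hqp (hp.2 hq.2.1 hqp))
  have hrad : Ideal.span {s} * p ≤ J.radical := by
    rw [← Ideal.sInf_minimalPrimes]
    refine le_sInf fun q hq ↦ ?_
    by_cases hqp : q = p
    · exact hqp ▸ Ideal.mul_le_right
    · refine Ideal.mul_le_left.trans ((Ideal.span_singleton_le_iff_mem _).2 ?_)
      exact (Finset.inf_le (f := id) (Finset.mem_erase.2 ⟨hqp, hfin.mem_toFinset.2 hq⟩) :
        _ ≤ q) hs
  obtain ⟨n, hn⟩ := Ideal.exists_pow_le_of_le_radical_of_fg hrad (IsNoetherian.noetherian _)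
  refine ⟨s ^ (n + 1), fun h ↦ hsp (hpp.mem_of_pow_mem _ h), n + 1, by simp, ?_⟩
  rw [← Ideal.span_singleton_pow, ← mul_pow]
  exact (Ideal.pow_le_pow_right n.le_succ).trans hn

theorem ringKrullDim_quotient_le_zero_of_maximalIdeal_mem_minimalPrimes {S : Type*} [CommRing S]
    [IsLocalRing S] {I : Ideal S} (h : IsLocalRing.maximalIdeal S ∈ I.minimalPrimes) :
    ringKrullDim (S ⧸ I) ≤ 0 := by
  have : Ring.KrullDimLE 0 (S ⧸ I) :=
    (Ideal.krullDimLE_zero_quotient_iff_forall_minimalPrimes_isMaximal).2 fun p hp ↦ by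
      have hle := IsLocalRing.le_maximalIdeal hp.1.1.ne_top
      rw [le_antisymm hle (h.2 hp.1 hle)]
      infer_instance
  exact Order.krullDimLE_iff .. |>.1 this

theorem IsRegularLocalRing.mem_support_localCohomology {S : Type u} [CommRing S]
    [IsRegularLocalRing S] {I : Ideal S} {p : PrimeSpectrum S} (hp : p.asIdeal ∈ I.minimalPrimes)
    {d m j : ℕ} (hd : ringKrullDim S = d) (hm : ringKrullDim (S ⧸ p.asIdeal) = m)
    (hj : j + 1 + m = d) :
    p ∈ Module.support S ((localCohomology I (j + 1)).obj (ModuleCat.of S S)) := by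
  have := nontrivial_ext_quotient hd hm hj
  obtain ⟨e, he⟩ := exists_ne (0 : Abelian.Ext (ModuleCat.of S (S ⧸ p.asIdeal))
    (ModuleCat.of S S) (j + 1))
  have hIp : I ^ 1 ≤ p.asIdeal := (pow_one I).le.trans hp.1.2
  let π : ModuleCat.of S (S ⧸ I ^ 1) ⟶ ModuleCat.of S (S ⧸ p.asIdeal) :=
    ModuleCat.ofHom (Submodule.mapQ _ _ LinearMap.id hIp)
  refine localCohomology.mem_support_of_ext I j 1 _ p
    ((Abelian.Ext.mk₀ π).comp e (zero_add _)) fun k hk r hr h0 ↦ he ?_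
  have hpk : p.asIdeal ∈ (I ^ k).minimalPrimes := by
    rwa [← Ideal.radical_minimalPrimes, Ideal.radical_pow _ (by omega),
      Ideal.radical_minimalPrimes]
  obtain ⟨s, hs, n, hn, hle⟩ := Ideal.exists_mul_pow_le_of_mem_minimalPrimes hpk
  let μ : S ⧸ p.asIdeal ^ n →ₗ[S] S ⧸ I ^ k :=
    Submodule.mapQ _ _ (LinearMap.lsmul S S s) fun x hx ↦
      hle (Ideal.mul_mem_mul (Ideal.mem_span_singleton_self s) hx)
  let ρ : S ⧸ p.asIdeal ^ n →ₗ[S] S ⧸ p.asIdeal :=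
    Submodule.mapQ _ _ LinearMap.id (Ideal.pow_le_self hn)
  have hρ : Function.Surjective ρ := by
    intro y
    obtain ⟨y, rfl⟩ := Submodule.mkQ_surjective _ y
    exact ⟨Submodule.mkQ _ y, rfl⟩
  -- Going through `S/I^k` only costs the factor `s ∉ p`, so a relation there becomes `rs`-torsion
  -- over `S/p^n`, independently of the other components of `I`.
  have hcomp : ModuleCat.ofHom μ ≫ localCohomology.quotientPowMap I hk ≫ π =
      s • ModuleCat.ofHom ρ := by
    refine ModuleCat.hom_ext (LinearMap.ext fun x ↦ ?_)
    obtain ⟨x, rfl⟩ := Submodule.mkQ_surjective _ x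
    rfl
  have h1 : (r * s) • (Abelian.Ext.mk₀ (ModuleCat.ofHom ρ)).comp e (zero_add _) = 0 := by
    have := congrArg (fun x ↦ (Abelian.Ext.mk₀ (ModuleCat.ofHom μ)).comp x (zero_add _)) h0
    simp only [Abelian.Ext.comp_smul, Abelian.Ext.mk₀_comp_mk₀_assoc, Abelian.Ext.comp_zero]
      at this
    rwa [hcomp, Abelian.Ext.mk₀_smul, Abelian.Ext.smul_comp, smul_smul] at this
  rw [← Abelian.Ext.comp_smul] at h1
  exact eq_zero_of_smul_ext_quotient_eq_zero hd hm hj (p.isPrime.mul_notMem hr hs)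
    (precomp_ext_quotient_pow_injective hd hm hj hn ρ hρ h1)

theorem WithBot.exists_eq_natCast_of_le {x : WithBot ℕ∞} {d : ℕ} (h0 : 0 ≤ x) (hd : x ≤ d) :
    ∃ m : ℕ, x = m := by
  obtain ⟨y, rfl⟩ := WithBot.ne_bot_iff_exists.1 (ne_bot_of_le_ne_bot (by decide) h0)
  have hy : y ≤ d := WithBot.coe_le_coe.1 hd
  obtain ⟨m, rfl⟩ := ENat.ne_top_iff_exists.1 (ne_top_of_le_ne_top (ENat.natCast_ne_top d) hy)
  exact ⟨m, rfl⟩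

end LocalCohomology

theorem mainTheorem10 (S : Type u) [CommRing S] [IsRegularLocalRing S] (I : Ideal S)
    (hI : IsCCIOnPuncturedSpectrum I) : IsEquidimensionalRing (S ⧸ I) := by
  suffices ∀ p ∈ I.minimalPrimes, ringKrullDim (S ⧸ p) = ringKrullDim (S ⧸ I) by
    intro q hq
    let f := Ideal.quotientMap q (Ideal.Quotient.mk I) le_rfl
    rw [← this _ ((Ideal.minimalPrimes_eq_comap (I := I)) ▸ Set.mem_image_of_mem _ hq),
      ringKrullDim_eq_of_ringEquiv (RingEquiv.ofBijective f
        ⟨Ideal.quotientMap_injective, Ideal.quotientMap_surjective Ideal.Quotient.mk_surjective⟩)]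
  intro p hp
  have hpp : p.IsPrime := hp.1.1
  refine le_antisymm (ringKrullDim_le_of_surjective (Ideal.Quotient.factor hp.1.2)
    (Ideal.Quotient.factor_surjective _)) ?_
  by_contra! hlt
  obtain ⟨d, hd⟩ : ∃ d : ℕ, ringKrullDim S = d :=
    ⟨_, (IsRegularLocalRing.spanFinrank_maximalIdeal (R := S)).symm⟩
  have hp0 : 0 ≤ ringKrullDim (S ⧸ p) := ringKrullDim_nonneg_of_nontrivial
  have hId : ringKrullDim (S ⧸ I) ≤ d := hd ▸ ringKrullDim_quotient_le I
  obtain ⟨m, hm⟩ := WithBot.exists_eq_natCast_of_le hp0 (hlt.le.trans hId)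
  obtain ⟨k, hk⟩ := WithBot.exists_eq_natCast_of_le (hp0.trans hlt.le) hId
  rw [hk] at hId hlt
  rw [hm] at hlt
  have hkd : k ≤ d := by exact_mod_cast hId
  have hmk : m < k := by exact_mod_cast hlt
  obtain ⟨j, hj⟩ : ∃ j, j + 1 + m = d := ⟨d - m - 1, by omega⟩
  -- Here `j + 1 = d - m` exceeds `t = d - k` because `m < k`.
  have hmem := hI (j + 1) (by
    rw [hd, hk]
    exact_mod_cast (by omega : d < k + (j + 1)))
    (IsRegularLocalRing.mem_support_localCohomology (p := ⟨p, hpp⟩) hp hd hm hj)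
  have hpn : p = IsLocalRing.maximalIdeal S := congrArg PrimeSpectrum.asIdeal hmem
  have h0 := ringKrullDim_quotient_le_zero_of_maximalIdeal_mem_minimalPrimes (hpn ▸ hp)
  rw [hk] at h0
  have : k ≤ 0 := by exact_mod_cast h0
  omega
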